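/- For a permutation $\pi=\pi_1\cdots\pi_n$ of $[n]$ (one-line notation), a left peak of $\pi$ is an index $i\in[n-1]$ with $\pi_i>\pi_{i+1}$ and either $i=1$ or $\pi_{i-1}<\pi_i$. Let $\operatorname{lpk}(\pi)$ be the number of left peaks of $\pi$, and let $\operatorname{ilpk}(\pi)=\operatorname{lpk}(\pi^{-1})$. Let $\operatorname{occ}_{m\cdots21}(\pi)$ be the number of occurrences of $m\cdots 21$ in $\pi$ as a consecutive pattern, that is, the number of indices $i\in[n-m+1]$ with $\pi_i>\pi_{i+1}>\cdots>\pi_{i+m-1}$. Put $$P_{m\cdots21,n}^{\operatorname{ilpk}}(s,t)=\sum_{\pi\in\mathfrak S_n}s^{\operatorname{occ}_{m\cdots21}(\pi)}t^{\operatorname{ilpk}(\pi)},\qquad P_{m\cdots21,n}^{\operatorname{ilpk}}(t)=P_{m\cdots21,n}^{\operatorname{ilpk}}(0,t),$$ both being $1$ for $n=0$. For formal power series in $s,x,t$, let $f^{*\langle n\rangle}$ be the $n$-fold Hadamard product of $f$ in the variable $t$ (coefficients of equal powers of $t$ are multiplied, with ordinary multiplication in $s$ and $x$), with $f^{*\langle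 0\rangle}=1/(1-t)$. Let $u=4t/(1+t)^2$ and $z=(1+t)x/(1-t)$. Theorem 4.8. Let $m\ge2$. As identities of formal power series, we have (a) $$\frac1{1-t}\sum_{n=0}^\infty P_{m\cdots21,n}^{\operatorname{ilpk}}(s,u)z^n=\sum_{n=0}^\infty\left(\frac{z}{1-t}+\frac{4t(s-1)z^m}{(1-t^2)(1+t)\left(1-(s-1)\sum_{l=1}^{m-1}z^l\right)}\right)^{*\langle n\rangle},$$ (b) $$\frac1{1-t}\sum_{n=0}^\infty P_{m\cdots21,n}^{\operatorname{ilpk}}(u)z^n=\sum_{n=0}^\infty\left(\frac{(1+t)^2z-4tz^m-(1-t)^2z^{m+1}}{(1-t^2)(1+t)(1-z^m)}\right)^{*\langle n\rangle},$$ and (c) $$\frac1{1-t}\sum_{n=0}^\infty P_{m\cdots21,n}^{\operatorname{ilpk}}(u)z^n=\frac1{1-x}+\sum_{k=1}^\infty\left[1-(2k+1)x+\sum_{j=1}^\infty\left(e_{m,j,k}x^{jm}-e'_{m,j,k}x^{jm+1}\right)\right]^{-1}t^k,$$ where $$e_{m,j,k}=4\sum_{l=1}^k\binom{l+jm-1}{l-1}\binom{jm-2}{k-l}\qquad\text{and}\qquad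 e'_{m,j,k}=4\sum_{l=1}^k\binom{l+jm}{l-1}\binom{jm-1}{k-l}.$$ -/

import Mathlib

namespace ClusterILPK

open Finset

/-- The standardization of a word `w` with distinct letters: the smallest letter is replaced by
`0`, the second smallest by `1`, and so on (letters of permutations are `0, …, m - 1` here). -/
def std {m : ℕ} (w : Fin m → ℕ) : Fin m → ℕ :=
  fun a => #{b : Fin m | w b < w a}

/-- `π_i π_{i+1} ⋯ π_{i+m-1}` is an occurrence of `σ` in `π` as a consecutive pattern
(positions are numbered from `0`). -/
def OccursAt {m n : ℕ} (σ : Equiv.Perm (Fin m)) (π : Equiv.Perm (Fin n)) (i : ℕ) : Prop :=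
  ∃ h : i + m ≤ n,
    std (fun a : Fin m => (π ⟨i + a, by omega⟩ : ℕ)) = fun a : Fin m => (σ a : ℕ)

instance {m n : ℕ} (σ : Equiv.Perm (Fin m)) (π : Equiv.Perm (Fin n)) :
    DecidablePred (OccursAt σ π) :=
  fun _ => inferInstanceAs (Decidable (∃ _, _))

/-- The number of occurrences of the consecutive pattern `σ` in `π`. -/
def occ {m n : ℕ} (σ : Equiv.Perm (Fin m)) (π : Equiv.Perm (Fin n)) : ℕ :=
  #{i ∈ range (n + 1) | OccursAt σ π i}

/-- `i` is a left peak of `π`: `π_i > π_{i+1}`, and `π_{i-1} < π_i` unless `i` is the first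
position. -/
def IsLeftPeak {n : ℕ} (π : Equiv.Perm (Fin n)) (i : ℕ) : Prop :=
  ∃ h : i + 1 < n, π ⟨i + 1, h⟩ < π ⟨i, by omega⟩ ∧
    (i = 0 ∨ π ⟨i - 1, by omega⟩ < π ⟨i, by omega⟩)

instance {n : ℕ} (π : Equiv.Perm (Fin n)) : DecidablePred (IsLeftPeak π) :=
  fun _ => inferInstanceAs (Decidable (∃ _, _))

/-- The left peak number. -/
def lpk {n : ℕ} (π : Equiv.Perm (Fin n)) : ℕ :=
  #{i ∈ range n | IsLeftPeak π i}

/-- The inverse left peak number. -/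
def ilpk {n : ℕ} (π : Equiv.Perm (Fin n)) : ℕ :=
  lpk π⁻¹

/-- The decreasing pattern `m ⋯ 2 1`. -/
def decPattern (m : ℕ) : Equiv.Perm (Fin m) :=
  Fin.revPerm

/-- The value at `(s, t)` of the polynomial `P_{σ,n}(s,t) = ∑_π s^{occ_σ(π)} t^{ilpk(π)}`, the sum
being over all permutations of length `n`. For `n = 0` it is `1` if `σ` is nonempty. -/
def P {m : ℕ} (σ : Equiv.Perm (Fin m)) (n : ℕ) {A : Type*} [CommRing A] (s t : A) : A :=
  ∑ π : Equiv.Perm (Fin n), s ^ occ σ π * t ^ ilpk π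

/-- The value at `t` of the polynomial `P_{σ,n}(t) = P_{σ,n}(0,t)`. -/
def PAvoid {m : ℕ} (σ : Equiv.Perm (Fin m)) (n : ℕ) {A : Type*} [CommRing A] (t : A) : A :=
  P σ n 0 t

/-- Formal power series in `x` over `ℚ[[s]]`. -/
abbrev SeriesX : Type := PowerSeries (PowerSeries ℚ)

/-- Formal power series in `s`, `x`, `t`, written as power series in `t` whose coefficients are
power series in `x` whose coefficients are power series in `s`. -/
abbrev Series : Type := PowerSeries SeriesX

noncomputable section

/-- The variable `x` of `SeriesX`. -/
def x₀ : SeriesX := PowerSeries.X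

/-- The variable `t`. -/
def t : Series := PowerSeries.X

/-- The variable `x`. -/
def x : Series := PowerSeries.C x₀

/-- The variable `s`. -/
def s : Series := PowerSeries.C (PowerSeries.C PowerSeries.X)

/-- The quotient `a / b` in a commutative ring, for a unit `b`. -/
def quo {A : Type*} [CommRing A] (a b : A) : A :=
  a * Ring.inverse b

/-- `quo a b` is the true quotient for series `b` with constant term `1`. -/
theorem quo_mul_cancel (a b : Series)
    (hb : PowerSeries.constantCoeff (PowerSeries.constantCoeff
      (PowerSeries.constantCoeff b)) = 1) : quo a b * b = a := by
  have h : IsUnit b := by simp [PowerSeries.isUnit_iff_constantCoeff, hb]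
  rw [quo, mul_assoc, Ring.inverse_mul_cancel _ h, mul_one]

/-- `quo a b` is the true quotient for series `b` in `x` with constant term `1`. -/
theorem quo_mul_cancel_X (a b : SeriesX)
    (hb : PowerSeries.constantCoeff (PowerSeries.constantCoeff b) = 1) : quo a b * b = a := by
  have h : IsUnit b := by simp [PowerSeries.isUnit_iff_constantCoeff, hb]
  rw [quo, mul_assoc, Ring.inverse_mul_cancel _ h, mul_one]

/-- `u = 4t / (1 + t)²`. -/
def u : Series := quo (4 * t) ((1 + t) ^ 2)

/-- `z = (1 + t) x / (1 - t)`. -/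
def z : Series := quo ((1 + t) * x) (1 - t)

/-- The Hadamard product in `t` (with ordinary multiplication in `s` and `x`). -/
def hadamard (f g : Series) : Series :=
  PowerSeries.mk fun k => PowerSeries.coeff k f * PowerSeries.coeff k g

/-- The `n`-fold Hadamard product in `t`; the empty product is the identity
`1 / (1 - t) = ∑ t^k` of the Hadamard product. -/
def hadamardPow (f : Series) : ℕ → Series
  | 0 => PowerSeries.mk fun _ => 1
  | n + 1 => hadamard (hadamardPow f n) f

/-- `S = ∑_{n ≥ 0} f n` as a formal sum of power series in `x`: each coefficient of the partial
sums is eventually equal to that of `S`. -/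
def HasFormalSumX (f : ℕ → SeriesX) (S : SeriesX) : Prop :=
  ∀ j : ℕ, ∃ N : ℕ, ∀ n ≥ N,
    PowerSeries.coeff j (∑ i ∈ range n, f i) = PowerSeries.coeff j S

/-- `S = ∑_{n ≥ 0} f n` as a formal sum of power series in `x` and `t`: each coefficient (of
`x^j t^k`) of the partial sums is eventually equal to that of `S`. -/
def HasFormalSum (f : ℕ → Series) (S : Series) : Prop :=
  ∀ k : ℕ, HasFormalSumX (fun n => PowerSeries.coeff k (f n)) (PowerSeries.coeff k S)

end

/-- The numbers `e_{m,j,k}` (used only for `j m ≥ 2`). -/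
def e (m j k : ℕ) : ℕ :=
  4 * ∑ l ∈ Icc 1 k, (l + j * m - 1).choose (l - 1) * (j * m - 2).choose (k - l)

/-- The numbers `e'_{m,j,k}` (used only for `j m ≥ 2`). -/
def e' (m j k : ℕ) : ℕ :=
  4 * ∑ l ∈ Icc 1 k, (l + j * m).choose (l - 1) * (j * m - 1).choose (k - l)

end ClusterILPK

/-! The proof counts words of length `n` in the letters `0, …, 2k` in two ways. An adjacent pair of
letters is a descent if it strictly decreases or repeats an odd letter; a word has weight `a ^ r`,
where `r` is its number of weakly decreasing factors of length `m` in this sense.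

Count by sorting: ordering the positions by `key` gives every word a permutation `π` with the same
descents, hence the same weight (`sum_words_eq_sum_perm`). The words belonging to `π` are left
enriched P-partitions for `π⁻¹`. Summed against `t^k`, their number gives `((1+t)/(1-t))^n u^ilpk(π)
/ (1-t)` (`one_sub_X_mul_chainGF_eq`), so the words yield `P_n(a,u) z^n / (1-t)` once `x^n` is
attached.

Count by runs: a weight `c_j` on decreasing prefixes of length `j`, with `1/(1 - c(x)) = ∑
a^max(r+1-m,0) x^r`, gives for each fixed `k` the series `1/(1 - ∑ c_j d_j x^j)`, where `d_j` counts
decreasing words (`wordSeries_mul`). A Hadamard power in `t` raises each coefficient of `t^k` to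
that power, so this geometric series is exactly the sum of Hadamard powers. Decreasing words are
themselves enriched P-partitions with at most one left peak, which puts `∑_k t^k ∑_j c_j d_j x^j` in
closed form (`IsRunWeight.mk_runSeries_mul`).

Taking `a = s` gives (a), `a = 0` gives (b), and reading off the coefficient of `t^k` for `a = 0`
gives (c). -/

namespace ClusterILPK

open Finset

/-! ### Linked words and left peaks of a descent pattern. -/

/-- The letter `c` may be followed by `c'` in a weakly increasing word, where equal letters are
allowed exactly for odd letters if `d` holds and for even letters otherwise. -/
def Links (d : Prop) (c c' : ℕ) : Prop := c < c' ∨ (c = c' ∧ (Odd c ↔ d))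

instance (d : Prop) [Decidable d] (c c' : ℕ) : Decidable (Links d c c') :=
  inferInstanceAs (Decidable (_ ∨ _))

/-- The number of linked words with `n + 1` letters and last letter `c`. -/
def chainCount (b : ℕ → Prop) [DecidablePred b] : ℕ → ℕ → ℕ
  | 0, _ => 1
  | n + 1, c => ∑ c' ∈ range c, chainCount b n c' +
      if (Odd c ↔ b n) then chainCount b n c else 0

theorem card_chains_last (b : ℕ → Prop) [DecidablePred b] (K n : ℕ) (c : Fin K) :
    #{g : Fin (n + 1) → Fin K |
      (∀ i : Fin n, Links (b i) (g i.castSucc) (g i.succ)) ∧ g (Fin.last n) = c} =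
      chainCount b n c := by
  induction n generalizing c with
  | zero =>
    rw [chainCount, card_eq_one]
    refine ⟨fun _ => c, ?_⟩
    ext g
    simp only [mem_filter, mem_univ, true_and, mem_singleton, IsEmpty.forall_iff]
    constructor
    · intro h
      funext i
      rw [← h, Fin.eq_zero i]
      rfl
    · rintro rfl; rfl
  | succ n ih =>
    have h1 : #{g : Fin (n + 2) → Fin K |
        (∀ i : Fin (n + 1), Links (b i) (g i.castSucc) (g i.succ)) ∧ g (Fin.last (n + 1)) = c} =
        #{g : Fin (n + 1) → Fin K |
          (∀ i : Fin n, Links (b i) (g i.castSucc) (g i.succ)) ∧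
            Links (b n) (g (Fin.last n)) c} := by
      refine card_bij' (fun g _ => Fin.init g)
        (fun g _ => Fin.snoc (α := fun _ => Fin K) g c) ?_ ?_ ?_ ?_
      · intro g hg
        simp only [mem_filter, mem_univ, true_and] at hg ⊢
        obtain ⟨h, rfl⟩ := hg
        exact ⟨fun i => h i.castSucc, h (Fin.last n)⟩
      · intro g hg
        simp only [mem_filter, mem_univ, true_and] at hg ⊢
        refine ⟨?_, Fin.snoc_last (α := fun _ => Fin K) _ _⟩
        rw [Fin.forall_fin_succ']
        refine ⟨fun i => ?_, ?_⟩
        · rw [Fin.succ_castSucc, Fin.snoc_castSucc (α := fun _ => Fin K),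
            Fin.snoc_castSucc (α := fun _ => Fin K)]
          exact hg.1 i
        · rw [Fin.succ_last, Fin.snoc_castSucc (α := fun _ => Fin K),
            Fin.snoc_last (α := fun _ => Fin K)]
          exact hg.2
      · intro g hg
        simp only [mem_filter, mem_univ, true_and] at hg
        rw [← hg.2]
        exact Fin.snoc_init_self g
      · intro g _
        exact Fin.init_snoc (α := fun _ => Fin K) _ _
    have h2 : #{g : Fin (n + 1) → Fin K |
          (∀ i : Fin n, Links (b i) (g i.castSucc) (g i.succ)) ∧
            Links (b n) (g (Fin.last n)) c} =
        ∑ c' : Fin K, if Links (b n) c' c then chainCount b n c' else 0 := by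
      rw [card_eq_sum_card_fiberwise (f := fun g => g (Fin.last n)) (t := univ)
        (fun _ _ => by simp)]
      refine sum_congr rfl fun c' _ => ?_
      rw [filter_filter]
      split_ifs with h
      · rw [← ih c']
        congr 1
        ext g
        simp only [mem_filter, mem_univ, true_and]
        constructor
        · rintro ⟨⟨h1, _⟩, h3⟩; exact ⟨h1, h3⟩
        · rintro ⟨h1, h3⟩; exact ⟨⟨h1, h3 ▸ h⟩, h3⟩
      · rw [card_eq_zero, filter_eq_empty_iff]
        rintro g - ⟨⟨_, h2⟩, h3⟩
        exact h (h3 ▸ h2)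
    rw [h1, h2, Fin.sum_univ_eq_sum_range
      (fun c' => if Links (b n) c' c then chainCount b n c' else 0) K, chainCount]
    have h3 : ∀ c', (if Links (b n) c' c then chainCount b n c' else 0) =
        (if c' < (c : ℕ) then chainCount b n c' else 0) +
        if c' = (c : ℕ) then (if (Odd c' ↔ b n) then chainCount b n c' else 0) else 0 := by
      intro c'
      unfold Links
      rcases lt_trichotomy c' (c : ℕ) with h | h | h
      · simp [h, h.ne]
      · simp [h]
      · simp [h.not_gt, h.ne']
    simp_rw [h3, sum_add_distrib]
    congr 1
    · rw [← sum_filter]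
      congr 1
      ext i
      simp only [mem_filter, mem_range]
      have := c.2
      omega
    · rw [sum_ite_eq' (range K) (c : ℕ), if_pos (mem_range.2 c.2)]

theorem card_chains (b : ℕ → Prop) [DecidablePred b] (K n : ℕ) :
    #{g : Fin (n + 1) → Fin K | ∀ i : Fin n, Links (b i) (g i.castSucc) (g i.succ)} =
      ∑ c ∈ range K, chainCount b n c := by
  rw [card_eq_sum_card_fiberwise (f := fun g => g (Fin.last n)) (t := univ)
    (fun _ _ => by simp), ← Fin.sum_univ_eq_sum_range (fun c => chainCount b n c) K]
  refine sum_congr rfl fun c _ => ?_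
  rw [filter_filter, card_chains_last]

/-- The number of left peaks among the first `n` positions of a descent pattern. -/
def peaks (b : ℕ → Prop) [DecidablePred b] (n : ℕ) : ℕ :=
  #{i ∈ range n | b i ∧ (i = 0 ∨ ¬ b (i - 1))}

/-! ### Generating function of linked words over the alphabet size. -/

section GeneratingFunction

open PowerSeries

variable (b : ℕ → Prop) [DecidablePred b] (R : Type*) [CommRing R]

/-- Linked words ending in an even letter. -/
noncomputable def evenGF (n : ℕ) : PowerSeries R := mk fun i => (chainCount b n (2 * i) : R)

/-- Linked words ending in an odd letter. -/
noncomputable def oddGF (n : ℕ) : PowerSeries R :=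
  mk fun i => if i = 0 then 0 else (chainCount b n (2 * i - 1) : R)

/-- Linked words in the letters below `2 i`. -/
noncomputable def belowEvenGF (n : ℕ) : PowerSeries R :=
  mk fun i => ((∑ c ∈ range (2 * i), chainCount b n c : ℕ) : R)

/-- Linked words in the letters below `2 i + 1`. -/
noncomputable def chainGF (n : ℕ) : PowerSeries R :=
  mk fun i => ((∑ c ∈ range (2 * i + 1), chainCount b n c : ℕ) : R)

/-- Multiplication by `1 - X` compares consecutive alphabets, which differ by one letter of each
parity. -/
theorem one_sub_X_mul_belowEvenGF (n : ℕ) :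
    (1 - X) * belowEvenGF b R n = X * evenGF b R n + oddGF b R n := by
  ext i
  rcases i with _ | i
  · simp [sub_mul, belowEvenGF, evenGF, oddGF]
  · simp only [sub_mul, one_mul, map_sub, map_add, coeff_succ_X_mul, belowEvenGF, evenGF, oddGF,
      coeff_mk, Nat.succ_ne_zero, if_false]
    rw [show 2 * (i + 1) = 2 * i + 1 + 1 by ring, sum_range_succ, sum_range_succ]
    push_cast
    ring

theorem one_sub_X_mul_chainGF (n : ℕ) :
    (1 - X) * chainGF b R n = evenGF b R n + oddGF b R n := by
  ext i
  rcases i with _ | i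
  · simp [sub_mul, chainGF, evenGF, oddGF]
  · simp only [sub_mul, one_mul, map_sub, map_add, coeff_succ_X_mul, chainGF, evenGF, oddGF,
      coeff_mk, Nat.succ_ne_zero, if_false]
    rw [show 2 * (i + 1) = 2 * i + 1 + 1 by ring, sum_range_succ, sum_range_succ]
    push_cast
    rw [show 2 * i + 1 + 1 = 2 * i + 2 from rfl]
    ring

variable {b}

theorem evenGF_succ_of_not {n : ℕ} (h : ¬ b n) : evenGF b R (n + 1) = chainGF b R n := by
  ext i
  simp [evenGF, chainGF, chainCount, h, sum_range_succ]

theorem oddGF_succ_of_not {n : ℕ} (h : ¬ b n) : oddGF b R (n + 1) = X * chainGF b R n := by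
  ext i
  rcases i with _ | i
  · simp [oddGF]
  · simp [oddGF, chainGF, chainCount, h, coeff_succ_X_mul,
      show 2 * (i + 1) - 1 = 2 * i + 1 by omega]

theorem evenGF_succ_of_desc {n : ℕ} (h : b n) : evenGF b R (n + 1) = belowEvenGF b R n := by
  ext i
  simp [evenGF, belowEvenGF, chainCount, h]

theorem oddGF_succ_of_desc {n : ℕ} (h : b n) : oddGF b R (n + 1) = belowEvenGF b R n := by
  ext i
  rcases i with _ | i
  · simp [oddGF, belowEvenGF]
  · simp [oddGF, belowEvenGF, chainCount, h,
      show 2 * (i + 1) = 2 * i + 1 + 1 by omega, sum_range_succ]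

variable (b)

theorem peaks_succ (n : ℕ) :
    peaks b (n + 1) = peaks b n + if b n ∧ (n = 0 ∨ ¬ b (n - 1)) then 1 else 0 := by
  unfold peaks
  rw [range_add_one, filter_insert]
  split_ifs with h
  · rw [card_insert_of_notMem (by simp)]
  · rfl

-- The second conjunct records the last step, with `E` and `O` the even and odd series. An ascent
-- multiplies `E + O` by `(1+X)/(1-X) = ρ`. A descent produces `2(XE + O)/(1-X)`: this is `ρ(E + O)`
-- if `E = O` (previous step a descent), but `4XE/(1-X) = ρu(E + O)` if `O = XE`. So a factor `u`
-- appears exactly at left peaks.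
variable {R} in
theorem chain_invariant {ρ u : PowerSeries R} (hρ : ρ * (1 - X) = 1 + X)
    (hu : u * (1 + X) ^ 2 = 4 * X) (h1 : IsUnit (1 - X : PowerSeries R))
    (h2 : IsUnit (1 + X : PowerSeries R)) (n : ℕ) :
    evenGF b R n + oddGF b R n = ρ ^ (n + 1) * u ^ peaks b n ∧
      if n ≠ 0 ∧ b (n - 1) then evenGF b R n = oddGF b R n
      else oddGF b R n = X * evenGF b R n := by
  induction n with
  | zero =>
    have hE : (1 - X) * evenGF b R 0 = 1 := by
      ext i
      rcases i with _ | i <;> simp [sub_mul, evenGF, chainCount, coeff_succ_X_mul, coeff_one]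
    have hO : oddGF b R 0 = X * evenGF b R 0 := by
      ext i
      rcases i with _ | i <;> simp [evenGF, oddGF, chainCount, coeff_succ_X_mul]
    refine ⟨?_, by simpa using hO⟩
    rw [hO]
    apply h1.mul_right_cancel
    simp only [peaks, range_zero, filter_empty, card_empty, pow_zero, zero_add, pow_one, mul_one,
      hρ]
    linear_combination (1 + X) * hE
  | succ n ih =>
    obtain ⟨hS, hlast⟩ := ih
    by_cases hb : b n
    · have key := one_sub_X_mul_belowEvenGF b R n
      rw [evenGF_succ_of_desc R hb, oddGF_succ_of_desc R hb]
      refine ⟨?_, by simp [hb]⟩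
      rw [peaks_succ]
      by_cases hl : n ≠ 0 ∧ b (n - 1)
      · rw [if_pos hl] at hlast
        rw [if_neg (by tauto), add_zero]
        apply h1.mul_right_cancel
        rw [pow_succ ρ (n + 1), mul_right_comm, mul_assoc (ρ ^ (n + 1)), mul_assoc (ρ ^ (n + 1)),
          hρ]
        linear_combination 2 * key + (1 + X) * hS + (X - 1) * hlast
      · rw [if_neg hl] at hlast
        rw [if_pos (by tauto)]
        apply h1.mul_right_cancel
        apply h2.mul_right_cancel
        rw [pow_succ ρ (n + 1), pow_succ u]
        linear_combination 2 * (1 + X) * key + 4 * X * hS + (2 - 2 * X) * hlast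
          - (ρ ^ (n + 1) * u ^ peaks b n) * (u * (1 + X) * hρ + hu)
    · have key := one_sub_X_mul_chainGF b R n
      rw [evenGF_succ_of_not R hb, oddGF_succ_of_not R hb]
      refine ⟨?_, by simp [hb]⟩
      rw [peaks_succ, if_neg (by tauto), add_zero]
      apply h1.mul_right_cancel
      rw [pow_succ ρ (n + 1)]
      linear_combination (1 + X) * key + (1 + X) * hS - (ρ ^ (n + 1) * u ^ peaks b n) * hρ

variable {R} in
theorem one_sub_X_mul_chainGF_eq {ρ u : PowerSeries R} (hρ : ρ * (1 - X) = 1 + X)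
    (hu : u * (1 + X) ^ 2 = 4 * X) (h1 : IsUnit (1 - X : PowerSeries R))
    (h2 : IsUnit (1 + X : PowerSeries R)) (n : ℕ) :
    (1 - X) * chainGF b R n = ρ ^ (n + 1) * u ^ peaks b n := by
  rw [one_sub_X_mul_chainGF, (chain_invariant b hρ hu h1 h2 n).1]

end GeneratingFunction

/-! ### Descents of permutations and words; occurrences as runs of descents. -/

/-- The positions `i` for which `i` and `i + 1` are related by `D`. -/
def Consec {n : ℕ} (D : Fin n → Fin n → Prop) (i : ℕ) : Prop :=
  ∃ h : i + 1 < n, D ⟨i, by omega⟩ ⟨i + 1, h⟩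

instance {n : ℕ} (D : Fin n → Fin n → Prop) [DecidableRel D] : DecidablePred (Consec D) :=
  fun _ => inferInstanceAs (Decidable (∃ _, _))

/-- The descents of a permutation. -/
def permDesc {n : ℕ} (π : Equiv.Perm (Fin n)) : ℕ → Prop := Consec fun i j => π j < π i

instance {n : ℕ} (π : Equiv.Perm (Fin n)) : DecidablePred (permDesc π) :=
  inferInstanceAs (DecidablePred (Consec _))

/-- The weak descents of a word, where equal letters form a descent if they are odd. -/
def wordDesc {n K : ℕ} (w : Fin n → Fin K) : ℕ → Prop :=
  Consec fun i j => w j < w i ∨ (w i = w j ∧ Odd (w i : ℕ))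

instance {n K : ℕ} (w : Fin n → Fin K) : DecidablePred (wordDesc w) :=
  inferInstanceAs (DecidablePred (Consec _))

/-- The first `q` letters of a word with descent pattern `b` form a run. -/
def StartsWithRun (b : ℕ → Prop) (q : ℕ) : Prop := ∀ i ∈ range (q - 1), b i

instance (b : ℕ → Prop) [DecidablePred b] (q : ℕ) : Decidable (StartsWithRun b q) :=
  decidable_of_iff (∀ i : Fin (q - 1), b i) ⟨fun h i hi => h ⟨i, mem_range.1 hi⟩,
    fun h i => h i (mem_range.2 i.2)⟩

/-- The number of factors of length `m` consisting of descents only. -/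
def runCount (m n : ℕ) (b : ℕ → Prop) [DecidablePred b] : ℕ :=
  #{i ∈ range (n + 1) | i + m ≤ n ∧ StartsWithRun (fun a => b (i + a)) m}

theorem std_eq_rev_iff {m : ℕ} (f : Fin m → ℕ) :
    (std f = fun a => (decPattern m a : ℕ)) ↔ StrictAnti f := by
  constructor
  · intro h a a' haa'
    by_contra! hle
    have h1 : std f a ≤ std f a' := by
      refine card_le_card fun b hb => ?_
      simp only [mem_filter, mem_univ, true_and] at hb ⊢
      omega
    rw [h] at h1
    simp only [decPattern, Fin.revPerm_apply, Fin.val_rev] at h1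
    have := a'.2
    have : (a : ℕ) < a' := haa'
    omega
  · intro h
    funext a
    have h1 : ({b : Fin m | f b < f a} : Finset (Fin m)) = Ioi a := by
      ext b
      simp [h.lt_iff_gt]
    rw [std, h1, Fin.card_Ioi]
    simp only [decPattern, Fin.revPerm_apply, Fin.val_rev]
    omega

theorem occursAt_decPattern_iff {m n : ℕ} (π : Equiv.Perm (Fin n)) (i : ℕ) :
    OccursAt (decPattern m) π i ↔
      i + m ≤ n ∧ StartsWithRun (fun a => permDesc π (i + a)) m := by
  unfold OccursAt
  simp_rw [std_eq_rev_iff]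
  constructor
  · rintro ⟨h, hs⟩
    refine ⟨h, fun a ha => ?_⟩
    rw [mem_range] at ha
    exact ⟨by omega, hs (show (⟨a, by omega⟩ : Fin m) < ⟨a + 1, by omega⟩ from Nat.lt_succ_self a)⟩
  · rintro ⟨h, hs⟩
    refine ⟨h, ?_⟩
    rcases m with _ | m
    · intro a; exact a.elim0
    · refine Fin.strictAnti_iff_succ_lt.2 fun a => ?_
      obtain ⟨_, h2⟩ := hs a (by simp)
      exact h2

theorem occ_decPattern {m n : ℕ} (π : Equiv.Perm (Fin n)) :
    occ (decPattern m) π = runCount m n (permDesc π) := by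
  unfold occ runCount
  congr 1
  ext i
  simp only [mem_filter, occursAt_decPattern_iff]

theorem not_permDesc_iff {n : ℕ} (π : Equiv.Perm (Fin n)) {i : ℕ} (h : i + 1 < n) :
    ¬ permDesc π i ↔ π ⟨i, by omega⟩ < π ⟨i + 1, h⟩ := by
  unfold permDesc Consec
  rw [not_exists]
  constructor
  · intro h1
    refine lt_of_le_of_ne (not_lt.1 (h1 h)) fun h2 => ?_
    simpa using π.injective h2
  · intro h1 _
    exact h1.not_gt

theorem lpk_eq_peaks {n : ℕ} (π : Equiv.Perm (Fin (n + 1))) : lpk π = peaks (permDesc π) n := by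
  unfold lpk peaks
  congr 1
  ext i
  simp only [mem_filter, mem_range]
  constructor
  · rintro ⟨_, h, h1, h2⟩
    refine ⟨by omega, ⟨h, h1⟩, ?_⟩
    rcases i with _ | i
    · exact Or.inl rfl
    · refine Or.inr ((not_permDesc_iff π (by omega)).2 ?_)
      simpa using h2
  · rintro ⟨h, ⟨_, h1⟩, h2⟩
    refine ⟨by omega, by omega, h1, ?_⟩
    rcases i with _ | i
    · exact Or.inl rfl
    · refine Or.inr ((not_permDesc_iff π (by omega)).1 ?_)
      simpa using h2

/-! ### Sorting words into permutations. -/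

/-- The sorting key of a position of a word: positions are compared by their letters, positions
with equal letters from left to right if the letter is even and from right to left if it is odd. -/
def key {n K : ℕ} (w : Fin n → Fin K) (i : Fin n) : ℕ ×ₗ ℤ :=
  toLex ((w i : ℕ), if Odd (w i : ℕ) then -(i : ℤ) else i)

theorem key_lt_iff {n K : ℕ} (w : Fin n → Fin K) (i j : Fin n) :
    key w i < key w j ↔ w i < w j ∨ (w i = w j ∧ if Odd (w i : ℕ) then j < i else i < j) := by
  unfold key
  rw [Prod.Lex.toLex_lt_toLex]
  simp only [Fin.val_inj, Fin.val_fin_lt]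
  refine or_congr_right (and_congr_right fun h => ?_)
  rw [h]
  split_ifs
  · rw [Fin.lt_def]; omega
  · rw [Fin.lt_def]; omega

theorem key_injective {n K : ℕ} (w : Fin n → Fin K) : Function.Injective (key w) := by
  intro i j h
  by_contra hne
  have h1 := (key_lt_iff w i j).not.1 h.not_lt
  have h2 := (key_lt_iff w j i).not.1 h.not_gt
  rcases lt_trichotomy (w i) (w j) with h3 | h3 | h3
  · exact h1 (Or.inl h3)
  · rcases lt_or_gt_of_ne hne with h4 | h4 <;> by_cases h5 : Odd (w j : ℕ) <;>
      simp_all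
  · exact h2 (Or.inl h3)

theorem existsUnique_strictMono_comp {n : ℕ} {α : Type*} [LinearOrder α] {f : Fin n → α}
    (hf : Function.Injective f) : ∃! σ : Equiv.Perm (Fin n), StrictMono (f ∘ σ) := by
  refine ⟨Tuple.sort f, (Tuple.monotone_sort f).strictMono_of_injective
    (hf.comp (Tuple.sort f).injective), fun σ hσ => ?_⟩
  rw [Tuple.eq_sort_iff]
  exact ⟨hσ.monotone, fun i j hij h => absurd h (hσ hij).ne⟩

/-- Here `π` ranks the positions by key. Ties between odd letters are ranked from right to left, so
a repeated odd letter becomes a descent of `π` and a repeated even letter an ascent. -/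
theorem wordDesc_iff_of_strictMono {n K : ℕ} {w : Fin n → Fin K} {π : Equiv.Perm (Fin n)}
    (h : StrictMono (key w ∘ ⇑π⁻¹)) (i : ℕ) : wordDesc w i ↔ permDesc π i := by
  unfold wordDesc permDesc Consec
  refine exists_congr fun hi => ?_
  have h1 : ∀ a b, π a < π b ↔ key w a < key w b := by
    intro a b
    rw [← h.lt_iff_lt]
    simp
  beta_reduce
  rw [h1, key_lt_iff]
  refine or_congr_right ?_
  rw [eq_comm]
  refine and_congr_right fun h2 => ?_
  rw [h2]
  split_ifs with h3
  · simp [h3]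
  · simp [h3]

/-- `g` lists the letters in sorted order. Two equal neighbours in this list are correctly ordered
when their positions, given by `σ`, decrease for an odd letter and increase for an even one; this is
how the descents of the inverse permutation enter. -/
theorem strictMono_key_iff {n K : ℕ} (g : Fin (n + 1) → Fin K) (σ : Equiv.Perm (Fin (n + 1))) :
    StrictMono (key (g ∘ ⇑σ⁻¹) ∘ σ) ↔
      ∀ i : Fin n, Links (permDesc σ i) (g i.castSucc) (g i.succ) := by
  rw [Fin.strictMono_iff_lt_succ]
  refine forall_congr' fun i => ?_
  have hinv : ∀ j, σ⁻¹ (σ j) = j := by simp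
  simp only [Function.comp_apply, key_lt_iff, hinv, Links, Fin.val_inj,
    Fin.val_fin_lt]
  refine or_congr_right (and_congr_right fun _ => ?_)
  have hd : permDesc σ i ↔ σ i.succ < σ i.castSucc := by
    unfold permDesc Consec
    exact ⟨fun ⟨_, h⟩ => h, fun h => ⟨by omega, h⟩⟩
  have hd' : ¬ permDesc σ i ↔ σ i.castSucc < σ i.succ :=
    not_permDesc_iff σ (i := i) (by omega)
  rw [← hd, ← hd']
  split_ifs with h <;> simp [h]

theorem runCount_congr (m n : ℕ) {b b' : ℕ → Prop} [DecidablePred b] [DecidablePred b']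
    (h : ∀ i, b i ↔ b' i) : runCount m n b = runCount m n b' := by
  unfold runCount StartsWithRun
  simp only [h]

/-- Sorting the positions of words: the words whose sorting permutation is given are counted by
linked words. -/
theorem sum_words_eq_sum_perm {R : Type*} [CommRing R] (a : R) (m n K : ℕ) :
    ∑ w : Fin (n + 1) → Fin K, a ^ runCount m (n + 1) (wordDesc w) =
      ∑ π : Equiv.Perm (Fin (n + 1)), a ^ occ (decPattern m) π *
        ((∑ c ∈ range K, chainCount (permDesc π⁻¹) n c : ℕ) : R) := by
  classical
  have h1 : ∀ w : Fin (n + 1) → Fin K, a ^ runCount m (n + 1) (wordDesc w) =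
      ∑ π : Equiv.Perm (Fin (n + 1)),
        if StrictMono (key w ∘ ⇑π⁻¹) then a ^ occ (decPattern m) π else 0 := by
    intro w
    obtain ⟨σ, hσ, huniq⟩ := existsUnique_strictMono_comp (key_injective w)
    -- `σ` lists positions in sorted order, so the ranking permutation is its inverse.
    rw [sum_eq_single σ⁻¹]
    · rw [if_pos (by simpa using hσ), occ_decPattern]
      congr 1
      exact runCount_congr m _ fun i => wordDesc_iff_of_strictMono (by simpa using hσ) i
    · intro π _ hne
      rw [if_neg]
      intro h
      exact hne (by rw [← huniq π⁻¹ h, inv_inv])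
    · simp
  simp_rw [h1]
  rw [sum_comm]
  refine sum_congr rfl fun π _ => ?_
  rw [← sum_filter, sum_const, nsmul_eq_mul, mul_comm]
  congr 2
  rw [← card_chains]
  refine card_bij' (fun w _ => w ∘ ⇑π⁻¹) (fun g _ => g ∘ ⇑π) ?_ ?_ ?_ ?_
  · intro w hw
    simp only [mem_filter, mem_univ, true_and] at hw ⊢
    rw [← strictMono_key_iff]
    convert hw using 3
    funext i
    simp
  · intro g hg
    simp only [mem_filter, mem_univ, true_and] at hg ⊢
    rw [← strictMono_key_iff] at hg
    simpa using hg
  · intro w _; funext i; simp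
  · intro g _; funext i; simp

/-! ### Decreasing factors and the maximal initial run. -/

theorem runCount_succ (m n : ℕ) (b : ℕ → Prop) [DecidablePred b] :
    runCount m (n + 1) b = runCount m n (fun i => b (i + 1)) +
      if m ≤ n + 1 ∧ StartsWithRun b m then 1 else 0 := by
  unfold runCount
  rw [card_filter, card_filter, sum_range_succ']
  congr 1
  · refine sum_congr rfl fun i _ => ?_
    have h1 : i + m + 1 ≤ n + 1 ↔ i + m ≤ n := by omega
    have h2 : ∀ a, i + 1 + a = i + a + 1 := fun a => by omega
    simp only [h2, h1]
  · simp only [zero_add]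

/-- No decreasing factor crosses the end of a maximal run, so the run accounts for its own `q + 1 -
m` factors (truncated subtraction) and the remainder is counted separately. -/
theorem runCount_of_initial_run {m : ℕ} (hm : 1 ≤ m) (q n : ℕ) (b : ℕ → Prop) [DecidablePred b]
    (hq : q ≤ n) (hb : ∀ i < q - 1, b i) (hl : q = 0 ∨ q = n ∨ ¬ b (q - 1)) :
    runCount m n b = q + 1 - m + runCount m (n - q) (fun i => b (i + q)) := by
  induction q generalizing n b with
  | zero => simp [Nat.sub_eq_zero_of_le hm]
  | succ q ih =>
    obtain ⟨n, rfl⟩ : ∃ n', n = n' + 1 := ⟨n - 1, by omega⟩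
    have hrec : runCount m n (fun i => b (i + 1)) =
        q + 1 - m + runCount m (n - q) (fun i => b (i + q + 1)) := by
      rcases q with _ | q
      · simp [Nat.sub_eq_zero_of_le hm]
      · refine ih n (fun i => b (i + 1)) (by omega) (fun i hi => hb _ (by omega)) ?_
        rcases hl with hl | hl | hl
        · omega
        · exact Or.inr (Or.inl (by omega))
        · exact Or.inr (Or.inr hl)
    have hiff : (m ≤ n + 1 ∧ StartsWithRun b m) ↔ m ≤ q + 1 := by
      constructor
      · rintro ⟨h1, h2⟩
        by_contra! h
        rcases hl with hl | hl | hl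
        · omega
        · omega
        · exact hl (h2 q (mem_range.2 (by omega)))
      · intro h
        refine ⟨by omega, fun a ha => hb _ ?_⟩
        rw [mem_range] at ha
        omega
    rw [runCount_succ, hrec]
    simp only [hiff, show n + 1 - (q + 1) = n - q by omega, show ∀ i, i + q + 1 = i + (q + 1) from fun _ => rfl]
    split_ifs <;> omega

theorem exists_initial_run (n : ℕ) (b : ℕ → Prop) :
    ∃ r, 1 ≤ r ∧ r ≤ n + 1 ∧ (∀ i < r - 1, b i) ∧ (r = n + 1 ∨ ¬ b (r - 1)) := by
  induction n with
  | zero => exact ⟨1, le_rfl, le_rfl, by simp, Or.inl rfl⟩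
  | succ n ih =>
    obtain ⟨r, h1, h2, h3, h4⟩ := ih
    by_cases hb : b (r - 1)
    · obtain rfl : r = n + 1 := by tauto
      refine ⟨n + 2, by omega, le_rfl, fun i hi => ?_, Or.inl rfl⟩
      rcases Nat.lt_succ_iff_lt_or_eq.1 (show i < n + 1 by omega) with h | rfl
      · exact h3 i (by omega)
      · exact hb
    · exact ⟨r, h1, by omega, h3, Or.inr hb⟩

/-! ### Cluster weights of runs. -/

section Weights

open PowerSeries

variable {R : Type*} [CommRing R]

theorem sum_Icc_pow_mul_one_sub {A : Type*} [CommRing A] (y : A) {m : ℕ} (hm : 1 ≤ m) :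
    (∑ l ∈ Icc 1 (m - 1), y ^ l) * (1 - y) = y - y ^ m := by
  obtain ⟨m, rfl⟩ : ∃ m', m = m' + 1 := ⟨m - 1, by omega⟩
  rw [Nat.add_sub_cancel]
  induction m with
  | zero => simp
  | succ m ih =>
    rw [sum_Icc_succ_top (by omega), add_mul, ih (by omega)]
    ring

/-- The series `c` satisfies the defining equation of the generating function of the cluster
weights of runs. -/
def IsRunWeight (a : R) (m : ℕ) (c : PowerSeries R) : Prop :=
  (c - X) * (1 - C (a - 1) * ∑ l ∈ Icc 1 (m - 1), X ^ l) = C (a - 1) * X ^ m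

theorem isUnit_one_sub_mul_sum (y : R) (m : ℕ) :
    IsUnit (1 - C y * ∑ l ∈ Icc 1 (m - 1), X ^ l : PowerSeries R) := by
  rw [isUnit_iff_constantCoeff]
  have : ∀ l ∈ Icc 1 (m - 1), (0 : R) ^ l = 0 := fun l hl =>
    zero_pow (by rw [mem_Icc] at hl; omega)
  simp [sum_congr rfl this]

theorem exists_isRunWeight (a : R) (m : ℕ) : ∃ c, IsRunWeight a m c := by
  obtain ⟨v, hv⟩ := (isUnit_one_sub_mul_sum (a - 1) m).exists_left_inv
  refine ⟨X + C (a - 1) * X ^ m * v, ?_⟩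
  rw [IsRunWeight, add_sub_cancel_left, mul_assoc, hv, mul_one]

theorem IsRunWeight.coeff_sub_of_lt {a : R} {m : ℕ} {c : PowerSeries R} (h : IsRunWeight a m c)
    {i : ℕ} (hi : i < m) : coeff i (c - X) = 0 := by
  obtain ⟨v, hv⟩ := (isUnit_one_sub_mul_sum (a - 1) m).exists_right_inv
  unfold IsRunWeight at h
  have h1 : c - X = X ^ m * (C (a - 1) * v) := by
    linear_combination (X - c) * hv + v * h
  rw [h1]
  exact X_pow_dvd_iff.1 (dvd_mul_right _ _) i hi

theorem IsRunWeight.coeff_zero {a : R} {m : ℕ} {c : PowerSeries R} (h : IsRunWeight a m c)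
    (hm : 1 ≤ m) : coeff 0 c = 0 := by
  simpa using h.coeff_sub_of_lt hm

/-- The run series `G` equals `Q / (1 - aX)`, since its exponent starts growing at length `m`; the
defining equation gives `1 - c = (1 - aX) / Q`, so `G = 1 / (1 - c)`. -/
theorem IsRunWeight.mul_runGF {a : R} {m : ℕ} {c : PowerSeries R} (h : IsRunWeight a m c)
    (hm : 1 ≤ m) :
    c * mk (fun r => a ^ (r + 1 - m)) = mk (fun r => a ^ (r + 1 - m)) - 1 := by
  set G : PowerSeries R := mk fun r => a ^ (r + 1 - m)
  set Q : PowerSeries R := 1 - C (a - 1) * ∑ l ∈ Icc 1 (m - 1), X ^ l with hQ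
  have hGQ : G * (1 - C a * X) = Q := by
    ext r
    rcases r with _ | r
    · have : ∀ l ∈ Icc 1 (m - 1), (0 : R) ^ l = 0 := fun l hl =>
        zero_pow (by rw [mem_Icc] at hl; omega)
      simp [G, hQ, Nat.sub_eq_zero_of_le hm, sum_congr rfl this]
    · rw [hQ, map_sub, coeff_C_mul, map_sum, mul_sub, mul_one, map_sub, mul_left_comm,
        coeff_C_mul, coeff_succ_mul_X]
      simp only [G, coeff_mk, coeff_X_pow, coeff_one, Nat.succ_ne_zero, if_false]
      rw [sum_ite_eq (Icc 1 (m - 1)) (r + 1)]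
      simp only [mem_Icc]
      split_ifs with h1
      · rw [show r + 1 + 1 - m = 0 by omega, show r + 1 - m = 0 by omega]
        ring
      · rw [show r + 1 + 1 - m = r + 1 - m + 1 by omega]
        ring
  have hU : IsUnit (1 - C a * X : PowerSeries R) := by
    rw [isUnit_iff_constantCoeff]; simp
  have hQU : IsUnit Q := isUnit_one_sub_mul_sum _ _
  have hgeom := sum_Icc_pow_mul_one_sub (X : PowerSeries R) hm
  have hC : (C (a - 1) : PowerSeries R) = C a - 1 := by simp
  unfold IsRunWeight at h
  rw [← hQ] at h
  clear_value Q G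
  apply hQU.mul_right_cancel
  apply hU.mul_right_cancel
  rw [hC] at hQ h
  linear_combination (c * Q - Q) * hGQ + Q * h + (X - 1) * Q * hQ + Q * (C a - 1) * hgeom

theorem IsRunWeight.sum_antidiagonal {a : R} {m : ℕ} {c : PowerSeries R} (h : IsRunWeight a m c)
    (hm : 1 ≤ m) (r : ℕ) :
    ∑ j ∈ range (r + 2), coeff j c * a ^ (r + 1 - j + 1 - m) = a ^ (r + 1 + 1 - m) := by
  have h1 := congrArg (coeff (r + 1)) (h.mul_runGF hm)
  rw [coeff_mul, Nat.sum_antidiagonal_eq_sum_range_succ_mk] at h1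
  simpa [coeff_one] using h1

/-- The expansion of the weight of a descent pattern over its initial runs. -/
theorem IsRunWeight.pow_runCount {a : R} {m : ℕ} {c : PowerSeries R} (h : IsRunWeight a m c)
    (hm : 1 ≤ m) (n : ℕ) (b : ℕ → Prop) [DecidablePred b] :
    a ^ runCount m (n + 1) b = ∑ p ∈ antidiagonal (n + 1), coeff p.1 c *
      if StartsWithRun b p.1 then a ^ runCount m p.2 (fun i => b (i + p.1)) else 0 := by
  obtain ⟨r, hr1, hrn, hb, hl⟩ := exists_initial_run n b
  obtain ⟨r, rfl⟩ : ∃ r', r = r' + 1 := ⟨r - 1, by omega⟩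
  rw [Nat.sum_antidiagonal_eq_sum_range_succ_mk]
  -- Prefixes longer than the maximal initial run, of length `r + 1`, contribute nothing.
  have hsub : range (r + 2) ⊆ range (n + 1).succ := range_subset_range.2 (by omega)
  rw [← sum_subset hsub]
  · rw [runCount_of_initial_run hm (r + 1) (n + 1) b hrn hb (Or.inr hl), pow_add,
      ← h.sum_antidiagonal hm r, sum_mul]
    refine sum_congr rfl fun j hj => ?_
    rw [mem_range] at hj
    have hrun : StartsWithRun b j := fun i hi => hb i (by rw [mem_range] at hi; omega)
    rw [if_pos hrun, mul_assoc, ← pow_add]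
    congr 2
    -- After `j` letters are removed, the rest still begins with a maximal run, now of length `r + 1
    -- - j`.
    have h1 := runCount_of_initial_run hm (r + 1 - j) (n + 1 - j) (fun i => b (i + j))
      (by omega) (fun i hi => hb _ (by omega)) (by
        rcases Nat.lt_succ_iff_lt_or_eq.1 hj with hj | rfl
        · rcases hl with hl | hl
          · exact Or.inr (Or.inl (by omega))
          · refine Or.inr (Or.inr ?_)
            rwa [show r + 1 - j - 1 + j = r + 1 - 1 by omega]
        · exact Or.inl (by omega))
    rw [h1, show n + 1 - j - (r + 1 - j) = n + 1 - (r + 1) by omega]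
    simp only [show ∀ i, i + (r + 1 - j) + j = i + (r + 1) by intro i; omega]
  · intro j hj hj'
    rw [mem_range] at hj hj'
    rw [if_neg, mul_zero]
    intro h1
    rcases hl with hl | hl
    · omega
    · exact hl (h1 _ (mem_range.2 (by omega)))

end Weights

/-! ### Recursion for weighted words. -/

/-- The number of weakly decreasing words, where equal letters are allowed if they are odd. -/
def descWords (j K : ℕ) : ℕ :=
  #{v : Fin j → Fin K | StartsWithRun (wordDesc v) j}

/-- The sum of `a ^ r` over all words of length `n`, where `r` is the number of weakly decreasing
factors of length `m`. -/
def wordSum {R : Type*} [CommRing R] (a : R) (m K n : ℕ) : R :=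
  ∑ w : Fin n → Fin K, a ^ runCount m n (wordDesc w)

theorem wordDesc_append_left {j l K : ℕ} (v : Fin j → Fin K) (w : Fin l → Fin K) {i : ℕ}
    (hi : i + 1 < j) : wordDesc (Fin.append v w) i ↔ wordDesc v i := by
  have h0 : Fin.append v w ⟨i, by omega⟩ = v ⟨i, by omega⟩ :=
    Fin.append_left v w ⟨i, by omega⟩
  have h1 : Fin.append v w ⟨i + 1, by omega⟩ = v ⟨i + 1, hi⟩ :=
    Fin.append_left v w ⟨i + 1, hi⟩
  unfold wordDesc Consec
  constructor
  · rintro ⟨_, h⟩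
    rw [h0, h1] at h
    exact ⟨hi, h⟩
  · rintro ⟨_, h⟩
    refine ⟨by omega, ?_⟩
    beta_reduce
    rw [h0, h1]
    exact h

theorem wordDesc_append_right {j l K : ℕ} (v : Fin j → Fin K) (w : Fin l → Fin K) (i : ℕ) :
    wordDesc (Fin.append v w) (i + j) ↔ wordDesc w i := by
  have h : ∀ (p : ℕ) (h : p < l) (h' : p + j < j + l),
      Fin.append v w ⟨p + j, h'⟩ = w ⟨p, h⟩ := by
    intro p h h'
    rw [← Fin.append_right v w ⟨p, h⟩]
    congr 1
    ext
    simp [add_comm]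
  have h2 : ∀ h' : i + j + 1 < j + l, Fin.append v w ⟨i + j + 1, h'⟩ = w ⟨i + 1, by omega⟩ := by
    intro h'
    rw [← h (i + 1) (by omega) (by omega)]
    congr 1
    ext
    simp only
    omega
  unfold wordDesc Consec
  constructor
  · rintro ⟨h1, h3⟩
    rw [h i (by omega), h2] at h3
    exact ⟨by omega, h3⟩
  · rintro ⟨h1, h3⟩
    refine ⟨by omega, ?_⟩
    beta_reduce
    rw [h i (by omega), h2]
    exact h3

/-- Neither the condition on the first `j` letters nor the count on the last `l` involves the
junction between them, so the sum factors. -/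
theorem sum_words_initial_run {R : Type*} [CommRing R] (a : R) (m K j l : ℕ) :
    ∑ w : Fin (j + l) → Fin K,
      (if StartsWithRun (wordDesc w) j then a ^ runCount m l (fun i => wordDesc w (i + j))
        else 0) = descWords j K * wordSum a m K l := by
  rw [← (Fin.appendEquiv j l).sum_comp, Fintype.sum_prod_type]
  unfold descWords wordSum
  rw [card_filter, Nat.cast_sum, sum_mul_sum]
  refine sum_congr rfl fun v _ => sum_congr rfl fun w _ => ?_
  set g := Fin.appendEquiv j l (v, w)
  have h1 : StartsWithRun (wordDesc g) j ↔ StartsWithRun (wordDesc v) j := by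
    refine forall₂_congr fun i hi => wordDesc_append_left v w ?_
    rw [mem_range] at hi
    omega
  have h2 : ∀ i, wordDesc g (i + j) ↔ wordDesc w i := wordDesc_append_right v w
  rw [runCount_congr m l h2]
  simp only [h1]
  split_ifs <;> simp

theorem wordSum_succ {R : Type*} [CommRing R] {a : R} {m : ℕ} {c : PowerSeries R}
    (h : IsRunWeight a m c) (hm : 1 ≤ m) (K n : ℕ) :
    wordSum a m K (n + 1) = ∑ p ∈ antidiagonal (n + 1),
      PowerSeries.coeff p.1 c * descWords p.1 K * wordSum a m K p.2 := by
  conv_lhs => rw [wordSum]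
  simp_rw [h.pow_runCount hm n]
  rw [sum_comm]
  refine sum_congr rfl fun ⟨j, l⟩ hp => ?_
  rw [Finset.HasAntidiagonal.mem_antidiagonal] at hp
  simp only at hp ⊢
  rw [mul_assoc, ← mul_sum]
  congr 1
  rw [← sum_words_initial_run]
  clear h
  generalize n + 1 = N at hp
  subst hp
  rfl

theorem wordSum_zero {R : Type*} [CommRing R] (a : R) {m : ℕ} (hm : 1 ≤ m) (K : ℕ) :
    wordSum a m K 0 = 1 := by
  have h : ∀ w : Fin 0 → Fin K, runCount m 0 (wordDesc w) = 0 := by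
    intro w
    rw [runCount, card_eq_zero, filter_eq_empty_iff]
    rintro i - ⟨h, -⟩
    omega
  simp [wordSum, h]

/-- Reversal turns a decreasing word into a linked word for the all-descent pattern. -/
theorem descWords_succ (j K : ℕ) :
    descWords (j + 1) K = ∑ c ∈ range K, chainCount (fun _ => True) j c := by
  rw [← card_chains, descWords]
  have key : ∀ v : Fin (j + 1) → Fin K, StartsWithRun (wordDesc v) (j + 1) ↔
      ∀ i : Fin j, Links True ((v ∘ Fin.rev) i.castSucc : Fin K) ((v ∘ Fin.rev) i.succ : Fin K) := by
    intro v
    have h1 : ∀ i : Fin j, wordDesc v i ↔ Links True (v i.succ : Fin K) (v i.castSucc : Fin K) := by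
      intro i
      have h2 : wordDesc v i ↔
          (v i.succ < v i.castSucc ∨ (v i.castSucc = v i.succ ∧ Odd (v i.castSucc : ℕ))) :=
        ⟨fun ⟨_, h⟩ => h, fun h => ⟨by omega, h⟩⟩
      rw [h2, Links, Fin.val_fin_lt, Fin.val_inj, iff_true, eq_comm]
      refine or_congr_right (and_congr_right fun h => by rw [h])
    constructor
    · intro h i
      simp only [Function.comp_apply, Fin.rev_castSucc, Fin.rev_succ]
      exact (h1 _).1 (h _ (mem_range.2 (Fin.rev i).2))
    · intro h i hi
      rw [mem_range] at hi
      have := h (Fin.rev ⟨i, by omega⟩)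
      simp only [Function.comp_apply, Fin.rev_castSucc, Fin.rev_succ, Fin.rev_rev] at this
      exact (h1 _).2 this
  refine card_bij' (fun v _ => v ∘ Fin.rev) (fun v _ => v ∘ Fin.rev) ?_ ?_ ?_ ?_
  · intro v hv
    simp only [mem_filter, mem_univ, true_and] at hv ⊢
    exact (key v).1 hv
  · intro v hv
    simp only [mem_filter, mem_univ, true_and] at hv ⊢
    rw [key]
    simpa using hv
  · intro v _; funext i; simp
  · intro v _; funext i; simp

theorem peaks_true (n : ℕ) : peaks (fun _ => True) n = if n = 0 then 0 else 1 := by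
  unfold peaks
  split_ifs with h
  · simp [h]
  · rw [card_eq_one]
    refine ⟨0, ?_⟩
    ext i
    simp only [mem_filter, mem_range, true_and, not_true, or_false, mem_singleton]
    omega

theorem descWords_one (K : ℕ) : descWords 1 K = K := by
  simp [descWords_succ, chainCount]

/-! ### Interchanging two power series variables. -/

open PowerSeries

section Swap

variable {B : Type*} [CommRing B]

/-- The isomorphism `B⟦y⟧⟦x⟧ ≃ B⟦x⟧⟦y⟧` as a ring homomorphism. -/
noncomputable def swap : PowerSeries (PowerSeries B) →+* PowerSeries (PowerSeries B) where
  toFun f := PowerSeries.mk fun k => PowerSeries.mk fun j => coeff k (coeff j f)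
  map_zero' := by ext; simp
  map_one' := by
    ext k j
    simp only [coeff_mk, coeff_one]
    split_ifs <;> simp_all [coeff_one]
  map_add' f g := by ext; simp
  map_mul' f g := by
    ext k j
    simp only [coeff_mk, coeff_mul, map_sum]
    rw [sum_comm]

@[simp]
theorem coeff_coeff_swap (f : PowerSeries (PowerSeries B)) (j k : ℕ) :
    coeff j (coeff k (swap f)) = coeff k (coeff j f) := by
  simp [swap]

@[simp]
theorem swap_X : swap (X : PowerSeries (PowerSeries B)) = C X := by
  ext k j
  simp only [coeff_coeff_swap, coeff_X, coeff_C]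
  split_ifs <;> simp_all [coeff_X, coeff_one]

@[simp]
theorem swap_C_X : swap (C X : PowerSeries (PowerSeries B)) = X := by
  ext k j
  simp only [coeff_coeff_swap, coeff_X, coeff_C]
  split_ifs <;> simp_all [coeff_X, coeff_one]

@[simp]
theorem swap_C_C (b : B) : swap (C (C b) : PowerSeries (PowerSeries B)) = C (C b) := by
  ext k j
  simp only [coeff_coeff_swap, coeff_C]
  split_ifs <;> simp_all [coeff_C]

end Swap

theorem map_P {m : ℕ} (σ : Equiv.Perm (Fin m)) (n : ℕ) {A A' : Type*} [CommRing A] [CommRing A']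
    (φ : A →+* A') (a b : A) : φ (P σ n a b) = P σ n (φ a) (φ b) := by
  simp [P]

theorem isUnit_one_sub_X (R : Type*) [CommRing R] : IsUnit (1 - X : PowerSeries R) := by
  rw [isUnit_iff_constantCoeff]; simp

theorem isUnit_one_add_X (R : Type*) [CommRing R] : IsUnit (1 + X : PowerSeries R) := by
  rw [isUnit_iff_constantCoeff]; simp

theorem quo_eq_of_mul_eq {A : Type*} [CommRing A] {f a b : A} (hb : IsUnit b) (h : f * b = a) :
    quo a b = f := by
  rw [quo, ← h, mul_assoc, Ring.mul_inverse_cancel _ hb, mul_one]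

theorem quo_mul_cancel_of_isUnit {A : Type*} [CommRing A] (a : A) {b : A} (hb : IsUnit b) :
    quo a b * b = a := by
  rw [quo, mul_assoc, Ring.inverse_mul_cancel _ hb, mul_one]

/-! ### The two evaluations of the word series. -/

section Series

variable {B : Type*} [CommRing B]

/-- The series `(1 + y) / (1 - y)`. -/
noncomputable def ratio (B : Type*) [CommRing B] : PowerSeries B := quo (1 + X) (1 - X)

/-- The series `4 y / (1 + y)²`. -/
noncomputable def peakSeries (B : Type*) [CommRing B] : PowerSeries B := quo (4 * X) ((1 + X) ^ 2)

theorem ratio_mul : ratio B * (1 - X) = 1 + X := quo_mul_cancel_of_isUnit _ (isUnit_one_sub_X B)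

theorem peakSeries_mul : peakSeries B * (1 + X) ^ 2 = 4 * X :=
  quo_mul_cancel_of_isUnit _ ((isUnit_one_add_X B).pow 2)

theorem one_sub_X_mul_descWords (n : ℕ) :
    (1 - X : PowerSeries B) * PowerSeries.mk (fun k => (descWords (n + 1) (2 * k + 1) : B)) =
      ratio B ^ (n + 1) * peakSeries B ^ (if n = 0 then 0 else 1) := by
  rw [← peaks_true, ← one_sub_X_mul_chainGF_eq (fun _ => True) ratio_mul peakSeries_mul
    (isUnit_one_sub_X B) (isUnit_one_add_X B)]
  congr 1
  ext k
  simp [descWords_succ, chainGF]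

theorem one_sub_X_mul_wordSum (a : B) {m : ℕ} (hm : 1 ≤ m) (n : ℕ) :
    (1 - X : PowerSeries B) * PowerSeries.mk (fun k => wordSum a m (2 * k + 1) n) =
      P (decPattern m) n (C a) (peakSeries B) * ratio B ^ n := by
  rcases n with _ | n
  · have h1 : ∀ π : Equiv.Perm (Fin 0), occ (decPattern m) π = 0 := by
      intro π
      rw [occ_decPattern, runCount, card_eq_zero, filter_eq_empty_iff]
      rintro i - ⟨h, -⟩
      omega
    have h2 : ∀ π : Equiv.Perm (Fin 0), ilpk π = 0 := fun π => by simp [ilpk, lpk]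
    simp only [wordSum_zero a hm, P, h1, h2, pow_zero, mul_one, sum_const, card_univ,
      Fintype.card_perm, Fintype.card_fin, Nat.factorial_zero, one_smul]
    ext k
    rcases k with _ | k <;> simp [sub_mul, coeff_succ_X_mul, coeff_one]
  · have h : PowerSeries.mk (fun k => wordSum a m (2 * k + 1) (n + 1)) =
        ∑ π : Equiv.Perm (Fin (n + 1)), C (a ^ occ (decPattern m) π) *
          chainGF (permDesc π⁻¹) B n := by
      ext k
      simp only [coeff_mk, wordSum, sum_words_eq_sum_perm, map_sum, coeff_C_mul, chainGF]
    rw [h, mul_sum, P, sum_mul]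
    refine sum_congr rfl fun π _ => ?_
    rw [mul_left_comm, one_sub_X_mul_chainGF_eq _ ratio_mul peakSeries_mul
      (isUnit_one_sub_X B) (isUnit_one_add_X B), ilpk, lpk_eq_peaks, map_pow]
    ring

/-- The generating function of runs with weights `c`. -/
noncomputable def runSeries (c : PowerSeries B) (k : ℕ) : PowerSeries B :=
  PowerSeries.mk fun j => coeff j c * descWords j (2 * k + 1)

/-- The generating function of the words in the letters `0, …, 2 k`. -/
noncomputable def wordSeries (a : B) (m k : ℕ) : PowerSeries B :=
  PowerSeries.mk fun n => wordSum a m (2 * k + 1) n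

/-- The recursion for `wordSum` is a renewal equation: a weighted decreasing prefix followed by an
arbitrary word. -/
theorem wordSeries_mul {a : B} {m : ℕ} {c : PowerSeries B} (h : IsRunWeight a m c) (hm : 1 ≤ m)
    (k : ℕ) : wordSeries a m k * (1 - runSeries c k) = 1 := by
  have h1 : runSeries c k * wordSeries a m k = wordSeries a m k - 1 := by
    ext n
    rcases n with _ | n
    · simp [runSeries, wordSeries, h.coeff_zero hm, wordSum_zero a hm, coeff_mul,
        -coeff_zero_eq_constantCoeff]
    · simp only [map_sub, coeff_one, Nat.succ_ne_zero, if_false, sub_zero]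
      rw [coeff_mul, wordSeries, coeff_mk, wordSum_succ h hm]
      simp only [runSeries, coeff_mk]
  linear_combination -h1

/-- The substitution `x ↦ (1 + t) x / (1 - t)`. -/
noncomputable def substRatio : PowerSeries B →+* PowerSeries (PowerSeries B) :=
  swap.comp ((rescale (ratio B)).comp (PowerSeries.map C))

theorem substRatio_X : substRatio (X : PowerSeries B) = swap (C (ratio B) * X) := by
  simp [substRatio, rescale_X]

theorem substRatio_C (b : B) : substRatio (C b : PowerSeries B) = C (C b) := by
  have : rescale (ratio B) (C (C b)) = C (C b) := by
    ext n : 1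
    rw [coeff_rescale, coeff_C]
    split_ifs with h <;> simp [h]
  simp [substRatio, this]

/-- Decreasing words of length one have no left peak and longer ones have exactly one. Since `c = X
+ O(X^m)` with `m ≥ 2`, only the part `c - X` picks up the factor `u`. -/
theorem IsRunWeight.mk_runSeries_mul {a : B} {m : ℕ} {c : PowerSeries B} (h : IsRunWeight a m c)
    (hm : 2 ≤ m) : PowerSeries.mk (runSeries c) * (1 - X) =
      substRatio X + swap (C (peakSeries B)) * substRatio (c - X) := by
  have h1 : PowerSeries.mk (runSeries c) =
      swap (PowerSeries.mk fun j => C (coeff j c) * PowerSeries.mk fun k => (descWords j (2 * k + 1) : B)) := by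
    ext k j
    simp [runSeries]
  have h2 : (1 - X : PowerSeries (PowerSeries B)) = swap (C (1 - X)) := by simp
  rw [h1, h2, substRatio]
  simp only [RingHom.comp_apply]
  rw [← map_mul, ← map_mul, ← map_add]
  congr 1
  ext j : 1
  rw [mul_comm _ (C _), coeff_C_mul, coeff_mk, map_add, coeff_C_mul]
  simp only [coeff_rescale, coeff_map]
  rw [mul_left_comm]
  have h0 := h.coeff_sub_of_lt (i := 1) (by omega)
  have hc : coeff j c = coeff j X + coeff j (c - X) := by rw [← map_add, add_sub_cancel]
  rcases j with _ | _ | j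
  · rw [h.coeff_zero (by omega), h.coeff_sub_of_lt (by omega)]
    simp
  · rw [hc, h0, one_sub_X_mul_descWords]
    simp
  · rw [hc, one_sub_X_mul_descWords]
    simp only [coeff_X, Nat.succ_ne_zero, if_false, zero_add, show j + 1 + 1 ≠ 1 by omega, map_zero,
      mul_zero, pow_one]
    ring

theorem one_sub_X_mul_wordSeries (a : B) {m : ℕ} (hm : 1 ≤ m) :
    (1 - X) * PowerSeries.mk (wordSeries a m) =
      swap (PowerSeries.mk fun n => P (decPattern m) n (C a) (peakSeries B) * ratio B ^ n) := by
  have h1 : PowerSeries.mk (wordSeries a m) = swap (PowerSeries.mk fun n => PowerSeries.mk fun k => wordSum a m (2 * k + 1) n) := by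
    ext k j
    simp [wordSeries]
  have h2 : (1 - X : PowerSeries (PowerSeries B)) = swap (C (1 - X)) := by simp
  rw [h1, h2, ← map_mul]
  congr 1
  ext n : 1
  rw [coeff_C_mul, coeff_mk, coeff_mk, one_sub_X_mul_wordSum a hm]

end Series

/-! ### Specialization to series in `s`, `x` and `t`. -/

theorem u_eq_swap : u = swap (C (peakSeries (PowerSeries ℚ))) := by
  refine quo_eq_of_mul_eq ((isUnit_one_add_X _).pow 2) ?_
  have h := congrArg (fun f => swap (C f)) (peakSeries_mul (B := PowerSeries ℚ))
  simpa [t, map_ofNat] using h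

theorem z_eq_swap : z = swap (C (ratio (PowerSeries ℚ)) * X) := by
  refine quo_eq_of_mul_eq (isUnit_one_sub_X _) ?_
  have h := congrArg (fun f => swap (C f)) (ratio_mul (B := PowerSeries ℚ))
  simp only [map_mul, map_sub, map_add, map_one, swap_C_X] at h
  rw [map_mul, swap_X, x, x₀, t]
  linear_combination C X * h

theorem z_eq_substRatio : z = substRatio X := by
  rw [z_eq_swap, substRatio_X]

theorem u_mul : u * (1 + t) ^ 2 = 4 * t :=
  quo_mul_cancel_of_isUnit _ ((isUnit_one_add_X _).pow 2)

theorem isUnit_one_sub_t : IsUnit (1 - t) := isUnit_one_sub_X _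

theorem isUnit_one_add_t : IsUnit (1 + t) := isUnit_one_add_X _

theorem isUnit_denominator : IsUnit ((1 - t ^ 2) * (1 + t)) := by
  have h : (1 - t ^ 2) * (1 + t) = (1 - t) * (1 + t) * (1 + t) := by ring
  rw [h]
  exact (isUnit_one_sub_t.mul isUnit_one_add_t).mul isUnit_one_add_t

/-- As `z ^ n` is `x ^ n` times a series in `t`, only the term `n = j` reaches `x ^ j`. -/
theorem hasFormalSum_words (a : PowerSeries ℚ) {m : ℕ} (hm : 1 ≤ m) :
    HasFormalSum (fun n => P (decPattern m) n (C (C a)) u * z ^ n)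
      ((1 - t) * PowerSeries.mk (wordSeries a m)) := by
  intro k j
  have hterm : ∀ n, P (decPattern m) n (C (C a)) u * z ^ n =
      swap (C (P (decPattern m) n (C a) (peakSeries _) * ratio _ ^ n) * X ^ n) := by
    intro n
    rw [map_mul C, map_pow C, mul_assoc, ← mul_pow, map_mul swap, map_pow swap,
      ← z_eq_swap]
    congr 1
    have h := map_P (decPattern m) n (swap.comp (C (R := PowerSeries (PowerSeries ℚ)))) (C a)
      (peakSeries _)
    simp only [RingHom.comp_apply, swap_C_C, ← u_eq_swap] at h
    exact h.symm
  refine ⟨j + 1, fun n hn => ?_⟩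
  rw [t, one_sub_X_mul_wordSeries a hm, coeff_coeff_swap, coeff_mk, map_sum]
  simp only [hterm, coeff_coeff_swap, coeff_C_mul, coeff_X_pow, mul_ite, mul_one, mul_zero]
  rw [sum_eq_single_of_mem j (mem_range.2 (by omega)) fun i _ hi => by rw [if_neg hi.symm, map_zero],
    if_pos rfl]

theorem coeff_hadamardPow (f : Series) (n k : ℕ) :
    coeff k (hadamardPow f n) = coeff k f ^ n := by
  induction n with
  | zero => simp [hadamardPow]
  | succ n ih => rw [hadamardPow, hadamard, coeff_mk, ih, pow_succ]

theorem hasFormalSumX_pow {f S : SeriesX} (hf : coeff 0 f = 0) (hS : S * (1 - f) = 1) :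
    HasFormalSumX (fun n => f ^ n) S := by
  intro j
  refine ⟨j + 1, fun n hn => ?_⟩
  have h1 : ∑ i ∈ range n, f ^ i = S - X ^ n * (S * (PowerSeries.mk fun p => coeff (p + 1) f) ^ n) := by
    have hX : f = X * PowerSeries.mk fun p => coeff (p + 1) f := by
      ext p : 1
      rcases p with _ | p
      · rw [hf]; simp
      · simp [coeff_succ_X_mul]
    have h2 := geom_sum_mul f n
    rw [mul_left_comm, ← mul_pow, ← hX]
    linear_combination (-S) * h2 - (∑ i ∈ range n, f ^ i) * hS
  rw [h1, map_sub, X_pow_dvd_iff.1 (dvd_mul_right _ _) j (by omega), sub_zero]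

theorem IsRunWeight.hasFormalSum_hadamardPow {a : PowerSeries ℚ} {m : ℕ} {c : SeriesX}
    (h : IsRunWeight a m c) (hm : 1 ≤ m) :
    HasFormalSum (hadamardPow (PowerSeries.mk (runSeries c))) (PowerSeries.mk (wordSeries a m)) := by
  intro k
  simp only [coeff_hadamardPow, coeff_mk]
  refine hasFormalSumX_pow ?_ (wordSeries_mul h hm k)
  rw [runSeries, coeff_mk, h.coeff_zero hm, zero_mul]

theorem quo_one_mul (f : Series) : quo 1 (1 - t) * ((1 - t) * f) = f := by
  rw [← mul_assoc, quo_mul_cancel_of_isUnit _ isUnit_one_sub_t, one_mul]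

theorem IsRunWeight.substRatio_eq {a : PowerSeries ℚ} {m : ℕ} {c : SeriesX}
    (h : IsRunWeight a m c) :
    substRatio (c - X) * (1 - (C (C a) - 1) * ∑ l ∈ Icc 1 (m - 1), z ^ l) =
      (C (C a) - 1) * z ^ m := by
  unfold IsRunWeight at h
  generalize c - X = d at h ⊢
  have h1 := congrArg substRatio h
  simpa only [map_mul, map_sub, map_one, map_sum, map_pow, substRatio_C, ← z_eq_substRatio]
    using h1

theorem IsRunWeight.mk_runSeries_mul_one_sub {a : PowerSeries ℚ} {m : ℕ} {c : SeriesX}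
    (h : IsRunWeight a m c) (hm : 2 ≤ m) :
    PowerSeries.mk (runSeries c) * (1 - t) = z + u * substRatio (c - X) := by
  rw [z_eq_substRatio, u_eq_swap, ← h.mk_runSeries_mul hm, t]

theorem IsRunWeight.mk_runSeries_eq {a : PowerSeries ℚ} {m : ℕ} {c : SeriesX}
    (h : IsRunWeight a m c) (hm : 2 ≤ m) :
    PowerSeries.mk (runSeries c) = quo z (1 - t) + quo (4 * t * (C (C a) - 1) * z ^ m)
      ((1 - t ^ 2) * (1 + t) * (1 - (C (C a) - 1) * ∑ l ∈ Icc 1 (m - 1), z ^ l)) := by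
  have hU : IsUnit (1 - (C (C a) - 1) * ∑ l ∈ Icc 1 (m - 1), z ^ l) := by
    have := (isUnit_one_sub_mul_sum (a - 1) m).map substRatio
    simpa only [map_mul, map_sub, map_one, map_sum, map_pow, substRatio_C, ← z_eq_substRatio]
      using this
  have h1 := h.substRatio_eq
  have h2 := h.mk_runSeries_mul_one_sub hm
  obtain ⟨i, hi⟩ := isUnit_one_sub_t.exists_right_inv
  have h3 : quo z (1 - t) = z * i :=
    quo_eq_of_mul_eq isUnit_one_sub_t (by linear_combination z * hi)
  rw [h3, quo_eq_of_mul_eq (f := u * substRatio (c - X) * i) (isUnit_denominator.mul hU)]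
  · linear_combination i * h2 - PowerSeries.mk (runSeries c) * hi
  · have h4 := u_mul
    generalize (1 - (C (C a) - 1) * ∑ l ∈ Icc 1 (m - 1), z ^ l) = Q at h1 ⊢
    linear_combination (u * (1 + t) ^ 2 * (1 - t) * i) * h1 + (C (C a) - 1) * z ^ m * (1 - t) * i * h4
      + 4 * t * (C (C a) - 1) * z ^ m * hi

/-! ### The avoiding case `a = 0` and its explicit coefficients. -/

theorem IsRunWeight.mul_one_sub_X_pow {R : Type*} [CommRing R] {m : ℕ} {c : PowerSeries R}
    (h : IsRunWeight 0 m c) (hm : 1 ≤ m) : (c - X) * (1 - X ^ m) = -(X ^ m * (1 - X)) := by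
  unfold IsRunWeight at h
  have hg := sum_Icc_pow_mul_one_sub (X : PowerSeries R) hm
  simp only [zero_sub, map_neg, map_one] at h
  linear_combination (1 - X) * h - (c - X) * hg

theorem IsRunWeight.mk_runSeries_eq_of_zero {m : ℕ} {c : SeriesX}
    (h : IsRunWeight (0 : PowerSeries ℚ) m c) (hm : 2 ≤ m) :
    PowerSeries.mk (runSeries c) =
      quo ((1 + t) ^ 2 * z - 4 * t * z ^ m - (1 - t) ^ 2 * z ^ (m + 1))
        ((1 - t ^ 2) * (1 + t) * (1 - z ^ m)) := by
  have hU : IsUnit (1 - z ^ m) := by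
    have hX : IsUnit (1 - X ^ m : SeriesX) := by
      rw [isUnit_iff_constantCoeff]
      simp [show m ≠ 0 by omega]
    simpa only [map_sub, map_one, map_pow, ← z_eq_substRatio] using hX.map substRatio
  have h1 := congrArg substRatio (h.mul_one_sub_X_pow (by omega))
  rw [map_mul, map_sub substRatio 1 (X ^ m), map_neg, map_mul, map_sub substRatio 1 X, map_pow,
    map_one, ← z_eq_substRatio] at h1
  have h2 := h.mk_runSeries_mul_one_sub hm
  have h4 := u_mul
  refine (quo_eq_of_mul_eq (isUnit_denominator.mul hU) ?_).symm
  linear_combination (1 + t) ^ 2 * (1 - z ^ m) * h2 + u * (1 + t) ^ 2 * h1 - z ^ m * (1 - z) * h4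

/-- For `a = 0`, `c - X = -(X^m - X^(m+1)) / (1 - X^m)`; its geometric expansion is cut after `n`
blocks with a remainder divisible by `X^(nm)`. -/
theorem IsRunWeight.coeff_sub_X_of_zero {R : Type*} [CommRing R] {m : ℕ} {c : PowerSeries R}
    (h : IsRunWeight 0 m c) (hm : 1 ≤ m) {n q : ℕ} (hq : q < n * m) :
    coeff q (c - X) = -∑ i ∈ range n,
      ((if q = (i + 1) * m then 1 else 0) - if q = (i + 1) * m + 1 then 1 else 0) := by
  have h1 : ∀ n : ℕ, c - X =
      -∑ i ∈ range n, (X ^ ((i + 1) * m) - X ^ ((i + 1) * m + 1)) + X ^ (n * m) * (c - X) := by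
    intro n
    induction n with
    | zero => simp
    | succ n ih =>
      rw [sum_range_succ]
      conv_lhs => rw [ih]
      rw [pow_succ, add_mul n 1 m, one_mul, pow_add]
      linear_combination X ^ (n * m) * h.mul_one_sub_X_pow hm
  rw [h1 n, map_add, X_pow_dvd_iff.1 (dvd_mul_right _ _) q hq, add_zero, map_neg, map_sum]
  simp only [map_sub, coeff_X_pow]

theorem coeff_one_add_X_pow (R : Type*) [CommRing R] (j k : ℕ) :
    coeff k ((1 + X : PowerSeries R) ^ j) = j.choose k := by
  rw [← Polynomial.coeff_one_add_X_pow R j k, ← Polynomial.coeff_coe]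
  simp

/-- The generating function over `k` simplifies to `4X (1+X)^j / (1-X)^(j+3)`, and the sum is the
convolution of the two binomial expansions. -/
theorem descWords_eq (j k : ℕ) :
    descWords (j + 2) (2 * k + 1) =
      4 * ∑ l ∈ Icc 1 k, (l + j + 1).choose (l - 1) * j.choose (k - l) := by
  have h1 := one_sub_X_mul_descWords (B := ℤ) (j + 1)
  rw [if_neg (Nat.succ_ne_zero j), pow_one] at h1
  have h2 : mk (fun k => (descWords (j + 2) (2 * k + 1) : ℤ)) =
      X * (C 4 * ((invOneSubPow ℤ (j + 3)).val * (1 + X) ^ j)) := by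
    have hinv : (1 - X : PowerSeries ℤ) ^ (j + 3) * (invOneSubPow ℤ (j + 3)).val = 1 := by
      rw [← invOneSubPow_inv_eq_one_sub_pow]
      exact (invOneSubPow ℤ (j + 3)).inv_val
    have hr : ratio ℤ ^ (j + 2) * (1 - X) ^ (j + 2) = (1 + X) ^ (j + 2) := by
      rw [← mul_pow, ratio_mul]
    apply ((isUnit_one_sub_X ℤ).pow (j + 3)).mul_left_cancel
    have hu := peakSeries_mul (B := ℤ)
    have h4 : (C 4 : PowerSeries ℤ) = 4 := by simp
    rw [h4]
    rw [show j + 1 + 1 = j + 2 from rfl] at h1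
    linear_combination (1 - X) ^ (j + 2) * h1 + peakSeries ℤ * hr + (1 + X) ^ j * hu
      - X * 4 * (1 + X) ^ j * hinv
  have h3 := congrArg (coeff k) h2
  rw [coeff_mk] at h3
  zify
  rw [h3]
  rcases k with _ | k
  · simp
  · rw [coeff_succ_X_mul, coeff_C_mul, coeff_mul, Nat.sum_antidiagonal_eq_sum_range_succ_mk]
    congr 1
    have hIcc : Icc 1 (k + 1) = Ico 1 (k + 2) := by ext; simp; omega
    rw [hIcc, sum_Ico_eq_sum_range]
    refine sum_congr rfl fun i _ => ?_
    rw [invOneSubPow_val_succ_eq_mk_add_choose, coeff_mk, coeff_one_add_X_pow]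
    rw [show 1 + i + j + 1 = i + (j + 2) by ring, show 1 + i - 1 = i by omega,
      show k + 1 - (1 + i) = k - i by omega, add_comm (j + 2) i, Nat.choose_symm_add]

theorem descWords_mul (m i k : ℕ) (hm : 2 ≤ m) :
    descWords ((i + 1) * m) (2 * k + 1) = e m (i + 1) k := by
  obtain ⟨j, hj⟩ : ∃ j, (i + 1) * m = j + 2 := ⟨(i + 1) * m - 2, by
    have : m ≤ (i + 1) * m := Nat.le_mul_of_pos_left m i.succ_pos; omega⟩
  rw [e, hj, descWords_eq]
  rfl

theorem descWords_mul_add_one (m i k : ℕ) (hm : 2 ≤ m) :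
    descWords ((i + 1) * m + 1) (2 * k + 1) = e' m (i + 1) k := by
  obtain ⟨j, hj⟩ : ∃ j, (i + 1) * m = j + 1 := ⟨(i + 1) * m - 1, by
    have : m ≤ (i + 1) * m := Nat.le_mul_of_pos_left m i.succ_pos; omega⟩
  rw [e', hj, descWords_eq]
  rfl

theorem IsRunWeight.coeff_one {R : Type*} [CommRing R] {a : R} {m : ℕ} {c : PowerSeries R}
    (h : IsRunWeight a m c) (hm : 2 ≤ m) : coeff 1 c = 1 := by
  have h1 := h.coeff_sub_of_lt (i := 1) (by omega)
  rwa [map_sub, coeff_one_X, sub_eq_zero] at h1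

/-- The only letter is `0`, which is even and so cannot repeat in a decreasing word. -/
theorem descWords_one_letter (j : ℕ) : descWords (j + 2) 1 = 0 := by
  simp [descWords_succ, chainCount]

theorem IsRunWeight.runSeries_zero {a : PowerSeries ℚ} {m : ℕ} {c : SeriesX}
    (h : IsRunWeight a m c) (hm : 2 ≤ m) : runSeries c 0 = x₀ := by
  ext q : 1
  rw [runSeries, coeff_mk, x₀]
  rcases q with _ | _ | q
  · rw [h.coeff_zero (by omega)]; simp
  · rw [zero_add, h.coeff_one hm, descWords_one]; simp
  · rw [descWords_one_letter, coeff_X, if_neg (by omega)]; simp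

theorem IsRunWeight.hasFormalSumX_of_zero {m : ℕ} {c : SeriesX}
    (h : IsRunWeight (0 : PowerSeries ℚ) m c) (hm : 2 ≤ m) (k : ℕ) :
    HasFormalSumX
      (fun i => (e m (i + 1) k : SeriesX) * x₀ ^ ((i + 1) * m) -
        (e' m (i + 1) k : SeriesX) * x₀ ^ ((i + 1) * m + 1))
      ((2 * (k : SeriesX) + 1) * x₀ - runSeries c k) := by
  intro q
  refine ⟨q + 1, fun n hn => ?_⟩
  have hcast : ∀ N : ℕ, (N : SeriesX) = C (N : PowerSeries ℚ) := fun N => by simp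
  have hk : (2 * (k : SeriesX) + 1) = C ((2 * k + 1 : ℕ) : PowerSeries ℚ) := by simp [map_ofNat]
  have hq : q < n * m := by nlinarith
  have h1 : coeff q ((2 * (k : SeriesX) + 1) * x₀ - runSeries c k) =
      -coeff q (c - X) * (descWords q (2 * k + 1) : PowerSeries ℚ) := by
    rw [hk, map_sub, coeff_C_mul, runSeries, coeff_mk, x₀, map_sub, coeff_X]
    split_ifs with hq1
    · rw [hq1, descWords_one]; ring
    · ring
  rw [h1, h.coeff_sub_X_of_zero (by omega) hq, neg_neg, sum_mul, map_sum]
  refine sum_congr rfl fun i _ => ?_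
  rw [map_sub, hcast, hcast, coeff_C_mul, coeff_C_mul, x₀, coeff_X_pow, coeff_X_pow, sub_mul]
  congr 1
  · split_ifs with h2
    · rw [h2, descWords_mul m i k hm]; ring
    · ring
  · split_ifs with h2
    · rw [h2, descWords_mul_add_one m i k hm]; ring
    · ring

theorem IsRunWeight.wordSeries_eq_quo {a : PowerSeries ℚ} {m : ℕ} {c : SeriesX}
    (h : IsRunWeight a m c) (hm : 1 ≤ m) (k : ℕ) :
    wordSeries a m k = quo 1 (1 - runSeries c k) := by
  have h1 := wordSeries_mul h hm k
  exact (quo_eq_of_mul_eq (IsUnit.of_mul_eq_one_right _ h1) h1).symm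

end ClusterILPK

open ClusterILPK in
theorem theorem4p8 (m : ℕ) (hm : 2 ≤ m) :
    -- (a)
    (∃ F : Series,
      HasFormalSum (fun n => P (decPattern m) n s u * z ^ n) F ∧
      HasFormalSum
        (hadamardPow
          (quo z (1 - t) +
            quo (4 * t * (s - 1) * z ^ m)
              ((1 - t ^ 2) * (1 + t) * (1 - (s - 1) * ∑ l ∈ Finset.Icc 1 (m - 1), z ^ l))))
        (quo 1 (1 - t) * F)) ∧
    ∃ G : Series,
      HasFormalSum (fun n => PAvoid (decPattern m) n u * z ^ n) G ∧
      -- (b)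
      HasFormalSum
        (hadamardPow
          (quo ((1 + t) ^ 2 * z - 4 * t * z ^ m - (1 - t) ^ 2 * z ^ (m + 1))
            ((1 - t ^ 2) * (1 + t) * (1 - z ^ m))))
        (quo 1 (1 - t) * G) ∧
      -- (c)
      ∃ E : ℕ → SeriesX,
        (∀ k ≥ 1,
          HasFormalSumX
            (fun i => (e m (i + 1) k : SeriesX) * x₀ ^ ((i + 1) * m) -
              (e' m (i + 1) k : SeriesX) * x₀ ^ ((i + 1) * m + 1))
            (E k)) ∧
        quo 1 (1 - t) * G =
          PowerSeries.mk fun k =>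
            if k = 0 then quo 1 (1 - x₀)
            else quo 1 (1 - (2 * (k : SeriesX) + 1) * x₀ + E k) := by
  have hm1 : 1 ≤ m := by omega
  constructor
  -- The inner variable `X` of `ℚ⟦X⟧` is `s`.
  · obtain ⟨c, hc⟩ := exists_isRunWeight (PowerSeries.X : PowerSeries ℚ) m
    refine ⟨_, hasFormalSum_words PowerSeries.X hm1, ?_⟩
    rw [quo_one_mul]
    have h := hc.hasFormalSum_hadamardPow hm1
    rw [hc.mk_runSeries_eq hm] at h
    exact h
  · obtain ⟨c, hc⟩ := exists_isRunWeight (0 : PowerSeries ℚ) m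
    -- `E k` is chosen so that `1 - (2k+1)x + E k = 1 - runSeries c k`.
    refine ⟨(1 - t) * PowerSeries.mk (wordSeries 0 m), ?_, ?_,
      fun k => (2 * (k : SeriesX) + 1) * x₀ - runSeries c k,
      fun k _ => hc.hasFormalSumX_of_zero hm k, ?_⟩
    · have h := hasFormalSum_words 0 hm1
      rw [map_zero, map_zero] at h
      exact h
    · rw [quo_one_mul, ← hc.mk_runSeries_eq_of_zero hm]
      exact hc.hasFormalSum_hadamardPow hm1
    · rw [quo_one_mul]
      congr 1
      funext k
      rw [hc.wordSeries_eq_quo hm1]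
      split_ifs with hk
      · rw [hk, hc.runSeries_zero hm]
      · congr 1
        ring
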